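/- **Setting.** Let $\mathcal L$ be the language of fields ($+,-,\cdot,{}^{-1},0,1$, with $0^{-1}=0$) expanded by relation symbols and constants. Let $T$ be a complete $\mathcal L$-open theory of topological fields of characteristic $0$, with topology defined by the $\mathcal L$-formula $\chi(y,\bar z)$. That is, every $K\models T$ is a non-discrete Hausdorff topological field of characteristic $0$ in which the sets $\chi(K,\bar b)$ that contain $0$ ($\bar b$ a tuple of $K$) form a basis of neighbourhoods of $0$, and every subset of $K^n$ definable with parameters is a finite union of sets $Z\cap U$ with $Z\subseteq K^n$ Zariski closed and $U\subseteq K^n$ open. Let $\mathcal A\in\Gamma^e(T)$. That is, $\mathcal A$ is an $\mathcal L$-substructure of a product $\prod_{x\in X}\mathcal A_x$ of models $\mathcal A_x$ of $T$ over a Boolean space $X=X(\mathcal A)$ (compact, Hausdorff, totally disconnected), projecting onto every $\mathcal A_x$, such that: * $[\varphi(\bar f)]^{\mathcal A}:=\{x\in X:\mathcal A_x\models\varphi(\bar f(x))\}$ is clopen for every $\mathcal L$-formula $\varphi$ and every tuple $\bar f$ of $A$; * (patchwork) for all $f,g\in A$ and every clopen $U\subseteq X$ there is $h\in A$ with $h=f$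 on $U$ and $h=g$ on $X\setminus U$. Write $X(\mathcal A)^*$ for the Boolean algebra of clopen subsets of $X$, and for a tuple $\bar b$ of $A$ put $\chi_p(A,\bar b):=\{y\in A: [\chi(y,\bar b)]^{\mathcal A}=X\}$. The sets $a+\chi_p(A,\bar b)$ with $0\in\chi_p(A,\bar b)$ are the basic neighbourhoods of $a\in A$. Let $\mathcal D$ be an $\mathcal L$-substructure of $\mathcal A$. For $x\in X$ let $\mathcal D_x$ be the substructure of $\mathcal A_x$ with domain $\{d(x):d\in D\}$, and for an $\mathcal L$-formula $\varphi$ and a tuple $\bar f$ of $D$ put $[\varphi(\bar f)]^{\mathcal D}:=\{x\in X:\mathcal D_x\models\varphi(\bar f(x))\}$. Suppose that $\mathcal D\models\Gamma^e(T)$ with respect to $X(\mathcal D)^*$. That is, all the sets $[\varphi(\bar f)]^{\mathcal D}$ are clopen, and, with $X(\mathcal D)^*\subseteq X(\mathcal A)^*$ the Boolean subalgebra of all these sets, for all $f,g\in D$ and $U\in X(\mathcal D)^*$ there is $h\in D$ with $h=f$ on $U$ and $h=g$ on $X\setminus U$. **Lemma.** Suppose that * (D1) $X(\mathcal D)^*\preceq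 X(\mathcal A)^*$ as Boolean algebras; * (D2) $\mathcal D_x$ is $\mathrm{acl}$-closed in $\mathcal A_x$ for every $x\in X$ (model-theoretic algebraic closure); * (D3) $D$ is dense in $A$: $(a+\chi_p(A,\bar b))\cap D\neq\emptyset$ for all $a\in A$ and all tuples $\bar b$ of $A$ with $0\in\chi_p(A,\bar b)$. Then $\mathcal D\preceq\mathcal A$. In particular this holds for every dense pair $(\mathcal A,\mathcal D)$, that is, if moreover (D4) holds: for every $x\in X$ and every $e\in X(\mathcal A)^*$ containing $x$ there is $\tilde e\in X(\mathcal D)^*$ with $x\in\tilde e\subseteq e$. Condition (D4) is not needed. -/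

import Mathlib

universe u v w z

namespace BoolProd

open FirstOrder FirstOrder.Language FirstOrder.Language.Structure

/-! ### Boolean algebras as first-order structures -/

/-- Function symbols of the language of Boolean algebras. -/
inductive BoolFunc : ℕ → Type
  | bot : BoolFunc 0
  | top : BoolFunc 0
  | compl : BoolFunc 1
  | inf : BoolFunc 2
  | sup : BoolFunc 2

/-- The language of Boolean algebras. -/
def boolLang : FirstOrder.Language.{0, 0} where
  Functions := BoolFunc
  Relations := fun _ => Empty

/-- Every Boolean algebra is a structure for the language of Boolean algebras. -/
instance boolStructure (B : Type*) [BooleanAlgebra B] : boolLang.Structure B where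
  funMap := fun {_} f =>
    match f with
    | BoolFunc.bot => fun _ => ⊥
    | BoolFunc.top => fun _ => ⊤
    | BoolFunc.compl => fun a => (a 0)ᶜ
    | BoolFunc.inf => fun a => a 0 ⊓ a 1
    | BoolFunc.sup => fun a => a 0 ⊔ a 1
  RelMap := fun {_} r => Empty.elim r

/-! ### Boolean products, in an arbitrary language -/

section General

variable {L : FirstOrder.Language.{u, v}} {X : Type z} {M : X → Type w} [∀ x, L.Structure (M x)]

/-- The direct product of a family of structures. -/
instance prodStructure : L.Structure (∀ x, M x) where
  funMap := fun f a x => funMap f (fun i => a i x)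
  RelMap := fun r a => ∀ x, RelMap r (fun i => a i x)

/-- Evaluation at `x`, as a homomorphism from a substructure of the product to the factor. -/
def evalHom (A : L.Substructure (∀ x, M x)) (x : X) : A →[L] M x where
  toFun := fun a => a.1 x
  map_fun' := fun _ _ => rfl
  map_rel' := fun _ _ h => h x

/-- The truth value `[φ(f)]`: the set of all `x` such that `φ(f(x))` holds in the factor at `x`. -/
def truthVal (A : L.Substructure (∀ x, M x)) {n : ℕ} (φ : L.Formula (Fin n)) (f : Fin n → A) :
    Set X :=
  {x | φ.Realize (fun i => (f i).1 x)}

/-- The set `[f = g]`. -/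
def eqSet {A : L.Substructure (∀ x, M x)} (f g : A) : Set X := {x | f.1 x = g.1 x}

/-- `A` is a subdirect product of models of `T` over the topological space `X`, and satisfies
the atomic extension property and the patchwork property. -/
structure IsGammaA [TopologicalSpace X] (T : L.Theory) (A : L.Substructure (∀ x, M x)) :
    Prop where
  model : ∀ x, M x ⊨ T
  subdirect : ∀ (x : X) (m : M x), ∃ a : A, a.1 x = m
  atomic : ∀ (n : ℕ) (φ : L.Formula (Fin n)), φ.IsAtomic → ∀ f : Fin n → A,
    IsClopen (truthVal A φ f)
  patchwork : ∀ (f g : A) (U : Set X), IsClopen U → ∃ h : A, U ⊆ eqSet f h ∧ Uᶜ ⊆ eqSet g h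

/-- In addition `A` satisfies the elementary extension property. -/
structure IsGammaE [TopologicalSpace X] (T : L.Theory) (A : L.Substructure (∀ x, M x)) : Prop
    extends IsGammaA T A where
  elementary : ∀ (n : ℕ) (φ : L.Formula (Fin n)) (f : Fin n → A), IsClopen (truthVal A φ f)

variable {A : L.Substructure (∀ x, M x)} (D : L.Substructure A)

/-- The substructure `D_x = {d(x) : d ∈ D}` of the factor at `x`. -/
def fiber (x : X) : L.Substructure (M x) := D.map (evalHom A x)

/-- The value `d(x)` of an element `d` of `D`, as an element of `D_x`. -/
def fiberVal (x : X) (d : D) : fiber D x := ⟨d.1.1 x, d.1, d.2, rfl⟩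

/-- The truth value `[φ(f)]^D`: the set of all `x` such that `φ(f(x))` holds in `D_x`. -/
def subTruthVal {n : ℕ} (φ : L.Formula (Fin n)) (f : Fin n → D) : Set X :=
  {x | φ.Realize (fun i => fiberVal D x (f i))}

theorem subTruthVal_inf {n m : ℕ} (φ : L.Formula (Fin n)) (ψ : L.Formula (Fin m))
    (f : Fin n → D) (g : Fin m → D) :
    subTruthVal D (φ.relabel (Fin.castAdd m) ⊓ ψ.relabel (Fin.natAdd n)) (Fin.append f g) =
      subTruthVal D φ f ∩ subTruthVal D ψ g := by
  ext x
  simp only [subTruthVal, Set.mem_ofPred_eq, Set.mem_inter_iff, Formula.realize_inf,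
    Formula.realize_relabel]
  refine and_congr (iff_of_eq ?_) (iff_of_eq ?_) <;> congr 1 <;> ext i <;> simp

theorem subTruthVal_not {n : ℕ} (φ : L.Formula (Fin n)) (f : Fin n → D) :
    subTruthVal D φ.not f = (subTruthVal D φ f)ᶜ := by
  ext x
  simp [subTruthVal, Formula.realize_not]

variable [TopologicalSpace X]

/-- The clopen sets of the form `[φ(f)]^D`. -/
def clopenVals : Set (TopologicalSpace.Clopens X) :=
  {U | ∃ (n : ℕ) (φ : L.Formula (Fin n)) (f : Fin n → D), (U : Set X) = subTruthVal D φ f}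

theorem clopenVals_compl {U : TopologicalSpace.Clopens X} (hU : U ∈ clopenVals D) :
    Uᶜ ∈ clopenVals D := by
  obtain ⟨n, φ, f, h⟩ := hU
  exact ⟨n, φ.not, f, by rw [subTruthVal_not, ← h]; rfl⟩

theorem clopenVals_inf {U V : TopologicalSpace.Clopens X} (hU : U ∈ clopenVals D)
    (hV : V ∈ clopenVals D) : U ⊓ V ∈ clopenVals D := by
  obtain ⟨n, φ, f, h⟩ := hU
  obtain ⟨m, ψ, g, h'⟩ := hV
  exact ⟨_, φ.relabel (Fin.castAdd m) ⊓ ψ.relabel (Fin.natAdd n), Fin.append f g,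
    (congrArg₂ (· ∩ ·) h h').trans (subTruthVal_inf D φ ψ f g).symm⟩

theorem clopenVals_bot : (⊥ : TopologicalSpace.Clopens X) ∈ clopenVals D :=
  ⟨0, ⊥, Fin.elim0, by ext x; simp [subTruthVal, Formula.realize_bot]⟩

/-- The Boolean subalgebra `X(D)^*` of the algebra `X(A)^*` of clopen subsets of `X`: it
consists of the clopen sets of the form `[φ(f)]^D`. -/
def clopenAlg : boolLang.Substructure (TopologicalSpace.Clopens X) where
  carrier := clopenVals D
  fun_mem := fun {_} f =>
    match f with
    | BoolFunc.bot => fun _ _ => clopenVals_bot D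
    | BoolFunc.top => fun _ _ => by
        have h := clopenVals_compl D (clopenVals_bot D)
        rwa [compl_bot] at h
    | BoolFunc.compl => fun _ h => clopenVals_compl D (h 0)
    | BoolFunc.inf => fun _ h => clopenVals_inf D (h 0) (h 1)
    | BoolFunc.sup => fun a h => by
        have h' := clopenVals_compl D
          (clopenVals_inf D (clopenVals_compl D (h 0)) (clopenVals_compl D (h 1)))
        rwa [compl_inf, compl_compl, compl_compl] at h'

/-- The substructure `D` is a model of `Γ^e(T)` with respect to `X(D)^*`: all sets `[φ(f)]^D`
are clopen, and `D` has the patchwork property with respect to the algebra of these sets. -/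
structure IsSubGammaE : Prop where
  elementary : ∀ (n : ℕ) (φ : L.Formula (Fin n)) (f : Fin n → D), IsClopen (subTruthVal D φ f)
  patchwork : ∀ (f g : D) (U : TopologicalSpace.Clopens X), U ∈ clopenAlg D →
    ∃ h : D, (U : Set X) ⊆ eqSet f.1 h.1 ∧ (U : Set X)ᶜ ⊆ eqSet g.1 h.1

end General

/-- A subset `B` of a structure is closed under model-theoretic algebraic closure: every element
of a finite set definable with parameters from `B` is in `B`. -/
def IsAclClosed (L : FirstOrder.Language.{u, v}) {K : Type w} [L.Structure K] (B : Set K) : Prop :=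
  ∀ S : Set K, S.Finite → B.Definable₁ L S → S ⊆ B

/-! ### Open theories of topological fields -/

/-- Function symbols of the language of fields. -/
inductive FieldFunc : ℕ → Type
  | zero : FieldFunc 0
  | one : FieldFunc 0
  | neg : FieldFunc 1
  | inv : FieldFunc 1
  | plus : FieldFunc 2
  | times : FieldFunc 2

/-- The language of fields: rings with a multiplicative inverse. -/
def fieldLang : FirstOrder.Language.{0, 0} where
  Functions := FieldFunc
  Relations := fun _ => Empty

/-- The expansion of the language of fields by the symbols of `L'`. -/
abbrev expLang (L' : FirstOrder.Language.{u, v}) : FirstOrder.Language.{u, v} := fieldLang.sum L'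

section Fields

variable {L' : FirstOrder.Language.{u, v}}

/-- Interpretation of a function symbol of the language of fields. -/
def fieldOp {K : Type w} [(expLang L').Structure K] {n : ℕ} (f : FieldFunc n) (a : Fin n → K) :
    K :=
  funMap (L := expLang L') (Sum.inl f) a

/-- The symbols of the language of fields have their usual meaning in the field `K`
(where `0⁻¹ = 0`). -/
structure IsFieldInterpretation (L' : FirstOrder.Language.{u, v}) (K : Type w) [(expLang L').Structure K]
    [Field K] : Prop where
  zero : fieldOp (L' := L') FieldFunc.zero ![] = (0 : K)
  one : fieldOp (L' := L') FieldFunc.one ![] = (1 : K)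
  neg : ∀ a : K, fieldOp (L' := L') FieldFunc.neg ![a] = -a
  inv : ∀ a : K, fieldOp (L' := L') FieldFunc.inv ![a] = a⁻¹
  plus : ∀ a b : K, fieldOp (L' := L') FieldFunc.plus ![a, b] = a + b
  times : ∀ a b : K, fieldOp (L' := L') FieldFunc.times ![a, b] = a * b

/-- The subset `χ(K, b)` of `K` defined by `χ(y, b)`; the first variable of `χ` is `y`. -/
def chiSet {K : Type w} [(expLang L').Structure K] {k : ℕ} (χ : (expLang L').Formula (Fin (k + 1)))
    (b : Fin k → K) : Set K :=
  {y | χ.Realize (Fin.cons y b : Fin (k + 1) → K)}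

/-- Zariski closed subsets of `K ^ n`. -/
def IsZariskiClosed {K : Type w} [Field K] {n : ℕ} (Z : Set (Fin n → K)) : Prop :=
  ∃ I : Set (MvPolynomial (Fin n) K), Z = {y | ∀ p ∈ I, MvPolynomial.eval y p = 0}

/-- `K` is a (non-discrete, Hausdorff) topological field of characteristic zero, the sets `χ(K, b)`
containing `0` form a basis of neighbourhoods of `0`, and every definable (with parameters) subset
of `K ^ n` is a finite union of intersections of a Zariski closed set and an open set. -/
structure IsOpenTopField {k : ℕ} (χ : (expLang L').Formula (Fin (k + 1))) (K : Type w)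
    [(expLang L').Structure K] [Field K] [TopologicalSpace K] : Prop where
  interpretation : IsFieldInterpretation L' K
  charZero : CharZero K
  topField : IsTopologicalDivisionRing K
  hausdorff : T2Space K
  nondiscrete : ¬ DiscreteTopology K
  basis : (nhds (0 : K)).HasBasis (fun b : Fin k → K => (0 : K) ∈ chiSet χ b) (chiSet χ)
  definable : ∀ (n : ℕ) (S : Set (Fin n → K)),
    (Set.univ : Set K).Definable (expLang L') S →
      ∃ (m : ℕ) (Z U : Fin m → Set (Fin n → K)),
        (∀ i, IsZariskiClosed (Z i)) ∧ (∀ i, IsOpen (U i)) ∧ S = ⋃ i, Z i ∩ U i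

/-- `T` is an open theory of topological fields of characteristic zero, whose topology is defined
by the formula `χ`. -/
def IsOpenTheory {k : ℕ} (T : (expLang L').Theory) (χ : (expLang L').Formula (Fin (k + 1))) :
    Prop :=
  ∀ (K : Type w) [(expLang L').Structure K], K ⊨ T →
    ∃ (_ : Field K) (_ : TopologicalSpace K), IsOpenTopField χ K

/-! ### Dense pairs -/

variable {X : Type z} {M : X → Type w} [∀ x, (expLang L').Structure (M x)]
  {A : (expLang L').Substructure (∀ x, M x)}

/-- The subset `χ_p(A, b)` of `A`: all `y` in `A` with `[χ(y, b)] = X`. -/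
def chiNhd {k : ℕ} (χ : (expLang L').Formula (Fin (k + 1))) (b : Fin k → A) : Set A :=
  {y | truthVal A χ (Fin.cons y b : Fin (k + 1) → A) = Set.univ}

/-- The conditions that make `(A, D)` a dense pair, except for the requirement (not needed here)
that every clopen neighbourhood of a point of `X` contain one that belongs to `X(D)^*`.
In the third condition, the sets `a + χ_p(A, b)` with `0 ∈ χ_p(A, b)` are the basic
neighbourhoods of `a` in the topology of `A`. -/
structure IsWeakDensePair [TopologicalSpace X] {k : ℕ} (χ : (expLang L').Formula (Fin (k + 1)))
    (D : (expLang L').Substructure A) : Prop where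
  clopenAlg_elementary : (clopenAlg D).IsElementary
  aclClosed : ∀ x, IsAclClosed (expLang L') (fiber D x : Set (M x))
  dense : ∀ (a : A) (b : Fin k → A), fieldOp (L' := L') FieldFunc.zero ![] ∈ chiNhd χ b →
    ∃ y ∈ chiNhd χ b, fieldOp (L' := L') FieldFunc.plus ![a, y] ∈ D

end Fields

end BoolProd

/-!
The theorem splits into a statement about the factors and a statement about Boolean products.

For every `x` the fibre `D_x` is an elementary substructure of the factor at `x`
(`fiber_isElementary`). A nonempty set definable over `D_x` is either finite, and then contained in
`D_x` because `D_x` is algebraically closed, or infinite. In the latter case it contains a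
nonempty open set because the theory is open (`IsOpenTopField.exists_chiSet_subset`), and this open
set meets `D_x` because `D` is dense in `A`. To apply density, the parameters of a basic
neighbourhood in one factor have to be lifted to parameters in `A` that define a neighbourhood of
zero at every point, which is done by compactness and patchwork (`IsGammaE.exists_tuple`).

Consequently the truth values of formulas with parameters in `D` are the same computed in the
fibres of `D` or in the factors, and both `A` and `D` are Boolean products over the same family of
structures, with respect to the algebra of all clopen sets and to `clopenAlg D`. A Feferman–Vaught
theorem that is uniform in the representation (`exists_boolFormula`) translates the truth of a
formula in either structure into the truth of one and the same first-order formula about finitely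
many truth values in the respective Boolean algebra. Since the smaller Boolean algebra is an
elementary substructure of the larger one, `D` is an elementary substructure of `A`
(`IsSubGammaE.isElementary`).

The quantifier step of the Feferman–Vaught theorem is a gluing argument based on compactness of `X`
(`exists_glue`). The algebra over which one glues need not separate points, so the argument applies
to `clopenAlg D` as well as to the algebra of all clopen sets.
-/

namespace BoolProd

open FirstOrder FirstOrder.Language FirstOrder.Language.Structure
open TopologicalSpace (Clopens)

/-! ### Gluing over a compact space -/

/-- Local sections with the patchwork property glue over a compact space: if around every point
some element of `E` satisfies `P`, then a single element of `E` satisfies `P` at every point. -/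
theorem exists_glue {X : Type*} [TopologicalSpace X] [CompactSpace X] {N : X → Type*}
    {E : Type*} [Nonempty E] (ev : E → ∀ x, N x) (𝓑 : Set (Set X)) (hopen : ∀ U ∈ 𝓑, IsOpen U)
    (hempty : ∅ ∈ 𝓑) (hunion : ∀ U ∈ 𝓑, ∀ V ∈ 𝓑, U ∪ V ∈ 𝓑)
    (patch : ∀ (f g : E), ∀ U ∈ 𝓑, ∃ h : E,
      (∀ x ∈ U, ev h x = ev f x) ∧ ∀ x ∉ U, ev h x = ev g x)
    (P : ∀ x, N x → Prop)
    (hloc : ∀ x, ∃ U ∈ 𝓑, x ∈ U ∧ ∃ g : E, ∀ y ∈ U, P y (ev g y)) :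
    ∃ g : E, ∀ x, P x (ev g x) := by
  have key : ∃ U ∈ 𝓑, Set.univ ⊆ U ∧ ∃ g : E, ∀ y ∈ U, P y (ev g y) := by
    refine isCompact_univ.induction_on
      (p := fun s => ∃ U ∈ 𝓑, s ⊆ U ∧ ∃ g : E, ∀ y ∈ U, P y (ev g y)) ?_ ?_ ?_ ?_
    · exact ⟨∅, hempty, subset_rfl, Classical.arbitrary E, fun y hy => hy.elim⟩
    · rintro s t hst ⟨U, hU, htU, h⟩
      exact ⟨U, hU, hst.trans htU, h⟩
    · rintro s t ⟨U, hU, hsU, f, hf⟩ ⟨V, hV, htV, g, hg⟩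
      obtain ⟨h, hhf, hhg⟩ := patch f g U hU
      refine ⟨U ∪ V, hunion U hU V hV, Set.union_subset_union hsU htV, h, fun y hy => ?_⟩
      by_cases hyU : y ∈ U
      · exact (hhf y hyU).symm ▸ hf y hyU
      · exact (hhg y hyU).symm ▸ hg y (hy.resolve_left hyU)
    · intro x _
      obtain ⟨U, hU, hxU, h⟩ := hloc x
      exact ⟨U, mem_nhdsWithin_of_mem_nhds ((hopen U hU).mem_nhds hxU), U, hU, subset_rfl, h⟩
  obtain ⟨U, -, hU, g, hg⟩ := key
  exact ⟨g, fun x => hg x (hU trivial)⟩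

/-! ### Boolean terms -/

section BooleanTerms

variable {X : Type z} [TopologicalSpace X] {ι : Type}

/-- The meet of a finite list of Boolean terms. -/
def meetTerm (t : List (boolLang.Term ι)) : boolLang.Term ι :=
  t.foldr (fun a b => Term.func BoolFunc.inf ![a, b]) (Term.func BoolFunc.top ![])

/-- The complement of a Boolean term. -/
def complTerm (t : boolLang.Term ι) : boolLang.Term ι := Term.func BoolFunc.compl ![t]

theorem mem_realize_compl (x : X) (t : boolLang.Term ι) (U : ι → Clopens X) :
    x ∈ (complTerm t).realize U ↔ x ∉ t.realize U := Iff.rfl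

theorem mem_realize_meet (x : X) (l : List (boolLang.Term ι)) (U : ι → Clopens X) :
    x ∈ (meetTerm l).realize U ↔ ∀ t ∈ l, x ∈ t.realize U := by
  induction l with
  | nil => exact iff_of_true trivial (by simp)
  | cons a l ih =>
    rw [List.forall_mem_cons, ← ih]
    exact Iff.rfl

open Classical in
/-- The Boolean term for the cell `⋂_{i ∈ s} U i ∩ ⋂_{i ∉ s} (U i)ᶜ` of the partition generated by
the sets `U i`. -/
noncomputable def cellTerm [Finite ι] (s : Set ι) : boolLang.Term ι :=
  letI := Fintype.ofFinite ι
  meetTerm ((Finset.univ : Finset ι).toList.map fun i =>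
    if i ∈ s then Term.var i else complTerm (Term.var i))

theorem mem_realize_cell [Finite ι] (x : X) (s : Set ι) (U : ι → Clopens X) :
    x ∈ (cellTerm s).realize U ↔ {i | x ∈ U i} = s := by
  classical
  simp only [cellTerm, mem_realize_meet, List.mem_map, Finset.mem_toList, Finset.mem_univ,
    true_and, forall_exists_index, forall_apply_eq_imp_iff, Set.ext_iff, Set.mem_ofPred_eq]
  refine forall_congr' fun i => ?_
  split_ifs with h
  · simp [h]
  · simp [h, mem_realize_compl]

end BooleanTerms

/-! ### The Feferman–Vaught theorem for Boolean products -/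

section FefermanVaught

variable {L : FirstOrder.Language.{u, v}} {X : Type z} {M : X → Type w} [∀ x, L.Structure (M x)]

/-- The truth value of a bounded formula: the set of all `x` such that it holds in the factor `M x`
for the values at `x` of the given elements of `E`. Truth is always taken in `M x`, never in a
proper substructure of it. -/
def boundedVal {E : Type*} [L.Structure E] (e : E ↪[L] (∀ x, M x)) {p n : ℕ}
    (φ : L.BoundedFormula (Fin p) n) (v : Fin p → E) (xs : Fin n → E) : Set X :=
  {x | φ.Realize (fun i => e (v i) x) (fun i => e (xs i) x)}

/-- The embedding `e` represents `E` as a Boolean product with respect to the Boolean algebra `B`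
of clopen sets: truth values belong to `B`, existential formulas that hold at a point have a
witness at that point that comes from `E`, and elements of `E` can be patched together over sets
of `B`. The algebra `B` may be smaller than the algebra of all clopen sets, and need not separate
points. -/
structure IsBooleanRep [TopologicalSpace X] {E B : Type*} [L.Structure E] [boolLang.Structure B]
    (e : E ↪[L] (∀ x, M x)) (j : B ↪[boolLang] Clopens X) : Prop where
  nonempty : Nonempty E
  val : ∀ {p n : ℕ} (φ : L.BoundedFormula (Fin p) n) (v : Fin p → E) (xs : Fin n → E),
    ∃ b : B, (j b : Set X) = boundedVal e φ v xs
  witness : ∀ {p n : ℕ} (φ : L.BoundedFormula (Fin p) (n + 1)) (v : Fin p → E) (xs : Fin n → E)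
    (x : X), x ∈ boundedVal e φ.ex v xs → ∃ g : E, x ∈ boundedVal e φ v (Fin.snoc xs g)
  patch : ∀ (f g : E) (b : B), ∃ h : E,
    (∀ x ∈ j b, e h x = e f x) ∧ ∀ x ∉ j b, e h x = e g x

theorem mem_realize_embedding [TopologicalSpace X] {B : Type*} [boolLang.Structure B]
    (j : B ↪[boolLang] Clopens X) {ι : Type} (t : boolLang.Term ι) (b : ι → B) :
    j (t.realize b) = t.realize (j ∘ b) :=
  (HomClass.realize_term j).symm

theorem exists_eq_bot [TopologicalSpace X] {B : Type*} [boolLang.Structure B]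
    (j : B ↪[boolLang] Clopens X) : ∃ b, j b = ⊥ :=
  ⟨_, mem_realize_embedding j (Term.func BoolFunc.bot ![] : boolLang.Term Empty) Empty.elim⟩

theorem exists_eq_sup [TopologicalSpace X] {B : Type*} [boolLang.Structure B]
    (j : B ↪[boolLang] Clopens X) (b₁ b₂ : B) : ∃ b, j b = j b₁ ⊔ j b₂ :=
  ⟨_, mem_realize_embedding j
    (Term.func BoolFunc.sup ![Term.var false, Term.var true] : boolLang.Term Bool)
    (fun i => cond i b₂ b₁)⟩

theorem exists_eq_inf [TopologicalSpace X] {B : Type*} [boolLang.Structure B]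
    (j : B ↪[boolLang] Clopens X) (b₁ b₂ : B) : ∃ b, j b = j b₁ ⊓ j b₂ :=
  ⟨_, mem_realize_embedding j
    (Term.func BoolFunc.inf ![Term.var false, Term.var true] : boolLang.Term Bool)
    (fun i => cond i b₂ b₁)⟩

theorem apply_realize_term {E : Type*} [L.Structure E] (e : E ↪[L] (∀ x, M x)) {α : Type*}
    (t : L.Term α) (a : α → E) (x : X) :
    e (t.realize a) x = t.realize fun i => e (a i) x := by
  induction t with
  | var => rfl
  | func f ts ih =>
    rw [Term.realize, Embedding.map_fun]
    exact congrArg (funMap f) (funext fun i => ih i)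

theorem mem_boundedVal_ex {E : Type*} [L.Structure E] (e : E ↪[L] (∀ x, M x)) {p n : ℕ}
    (φ : L.BoundedFormula (Fin p) (n + 1)) (v : Fin p → E) (xs : Fin n → E) (x : X) :
    x ∈ boundedVal e φ.ex v xs ↔
      ∃ m, φ.Realize (fun i => e (v i) x) (Fin.snoc (fun i => e (xs i) x) m) := by
  exact BoundedFormula.realize_ex

theorem mem_boundedVal_snoc {E : Type*} [L.Structure E] (e : E ↪[L] (∀ x, M x)) {p n : ℕ}
    (φ : L.BoundedFormula (Fin p) (n + 1)) (v : Fin p → E) (xs : Fin n → E) (g : E) (x : X) :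
    x ∈ boundedVal e φ v (Fin.snoc xs g) ↔
      φ.Realize (fun i => e (v i) x) (Fin.snoc (fun i => e (xs i) x) (e g x)) := by
  have h : (fun i => e ((Fin.snoc xs g : Fin (n + 1) → E) i) x) =
      (Fin.snoc (fun i => e (xs i) x) (e g x) : Fin (n + 1) → M x) := by
    ext i
    refine Fin.lastCases ?_ (fun i => ?_) i <;> simp
  rw [boundedVal, Set.mem_ofPred_eq, h]

/-- Truth values of bounded formulas are truth values of formulas in variables `Fin n`, which are
those that the properties `Γ^e` speak of. -/
theorem exists_formula_eq_boundedVal {E : Type*} [L.Structure E] (e : E ↪[L] (∀ x, M x)) {p n : ℕ}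
    (φ : L.BoundedFormula (Fin p) n) (v : Fin p → E) (xs : Fin n → E) :
    ∃ (ψ : L.Formula (Fin (p + n))) (f : Fin (p + n) → E),
      boundedVal e φ v xs = {x | ψ.Realize fun i => e (f i) x} := by
  refine ⟨φ.toFormula.relabel finSumFinEquiv, Fin.append v xs, ?_⟩
  ext x
  rw [Set.mem_ofPred_eq, Formula.realize_relabel, BoundedFormula.realize_toFormula, boundedVal,
    Set.mem_ofPred_eq]
  refine iff_of_eq (congrArg₂ _ ?_ ?_) <;> ext i <;> simp

open Classical in
/-- The formula stating that `s` is exactly the set of those `i` for which `ψ i` holds. -/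
noncomputable def cellFormula {ι : Type} [Finite ι] {p n : ℕ}
    (ψ : ι → L.BoundedFormula (Fin p) n) (s : Set ι) : L.BoundedFormula (Fin p) n :=
  BoundedFormula.iInf fun i => if i ∈ s then ψ i else (ψ i).not

theorem realize_cellFormula {ι : Type} [Finite ι] {p n : ℕ}
    (ψ : ι → L.BoundedFormula (Fin p) n) (s : Set ι) {N : Type*} [L.Structure N]
    (v : Fin p → N) (xs : Fin n → N) :
    (cellFormula ψ s).Realize v xs ↔ {i | (ψ i).Realize v xs} = s := by
  classical
  simp only [cellFormula, BoundedFormula.realize_iInf, Set.ext_iff, Set.mem_ofPred_eq]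
  refine forall_congr' fun i => ?_
  split_ifs with h <;> simp [h]

/-- If `Φ` expresses a formula in terms of the truth values of the `ψ i`, this expresses its
universal closure in the last variable in terms of the truth values `V s` of
`∃ y, cellFormula ψ s`: the families `U` of the form `([ψ i(y)])_i` are exactly those for which
every cell of `U` is contained in the corresponding set `V s`. Containment is written as
`cell ⊓ V s = cell`. -/
noncomputable def allFormula {ι : Type} [Finite ι] (Φ : boolLang.Formula ι) :
    boolLang.Formula (Set ι) :=
  Formula.iAlls ι
    ((BoundedFormula.iInf fun s : Set ι =>
      Term.equal
        (Term.func BoolFunc.inf ![(cellTerm s).relabel Sum.inr, Term.var (Sum.inl s)])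
        ((cellTerm s).relabel Sum.inr) : boolLang.Formula (Set ι ⊕ ι)).imp
    (Φ.relabel Sum.inr))

variable [TopologicalSpace X]

theorem realize_allFormula {ι : Type} [Finite ι] (Φ : boolLang.Formula ι) {B : Type*}
    [boolLang.Structure B] (j : B ↪[boolLang] Clopens X) (b : Set ι → B) :
    (allFormula Φ).Realize b ↔
      ∀ c : ι → B, (∀ x, x ∈ j (b {i | x ∈ j (c i)})) → Φ.Realize c := by
  rw [allFormula, Formula.realize_iAlls]
  refine forall_congr' fun c => ?_
  rw [Formula.realize_imp, Formula.realize_relabel]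
  refine imp_congr ?_ Iff.rfl
  rw [Formula.Realize, BoundedFormula.realize_iInf]
  have h : ∀ s : Set ι, (Term.equal
        (Term.func BoolFunc.inf ![(cellTerm s).relabel Sum.inr, Term.var (Sum.inl s)])
        ((cellTerm s).relabel Sum.inr) : boolLang.Formula (Set ι ⊕ ι)).Realize
          (fun a => Sum.elim b c a) ↔ ∀ x, {i | x ∈ j (c i)} = s → x ∈ j (b s) := by
    intro s
    rw [Formula.realize_equal, ← j.injective.eq_iff, mem_realize_embedding,
      mem_realize_embedding]
    have hc : ∀ x, x ∈ ((cellTerm s).relabel (Sum.inr : ι → Set ι ⊕ ι)).realize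
        (j ∘ fun a => Sum.elim b c a) ↔ {i | x ∈ j (c i)} = s := fun x => by
      rw [Term.realize_relabel, mem_realize_cell]
      rfl
    have hinf : (Term.func BoolFunc.inf
        ![(cellTerm s).relabel Sum.inr, Term.var (Sum.inl s)] : boolLang.Term (Set ι ⊕ ι)).realize
        (j ∘ fun a => Sum.elim b c a) =
        ((cellTerm s).relabel Sum.inr).realize (j ∘ fun a => Sum.elim b c a) ⊓ j (b s) := rfl
    rw [hinf, inf_eq_left]
    exact forall_congr' fun x => imp_congr (hc x) Iff.rfl
  refine (forall_congr' h).trans ⟨fun H x => H _ x rfl, ?_⟩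
  rintro H s x rfl
  exact H x

/-- The Feferman–Vaught theorem for Boolean products: the truth of `φ` in `E` is expressed by a
first-order formula about the truth values of finitely many formulas. The formula `Φ` is the same
for all representations over the factors `M`; this uniformity allows two of them to be compared.
-/
theorem exists_boolFormula [CompactSpace X] {p n : ℕ} (φ : L.BoundedFormula (Fin p) n) :
    ∃ (ι : Type) (_ : Finite ι) (ψ : ι → L.BoundedFormula (Fin p) n) (Φ : boolLang.Formula ι),
      ∀ {E : Type (max w z)} {B : Type z} [L.Structure E] [boolLang.Structure B]
        (e : E ↪[L] (∀ x, M x)) (j : B ↪[boolLang] Clopens X), IsBooleanRep e j →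
        ∀ (v : Fin p → E) (xs : Fin n → E) (b : ι → B),
          (∀ i, (j (b i) : Set X) = boundedVal e (ψ i) v xs) →
          (φ.Realize v xs ↔ Φ.Realize b) := by
  -- the formula `U = ⊤` expresses that an atomic formula holds at every point
  have htop : ∀ {B : Type z} [boolLang.Structure B] (j : B ↪[boolLang] Clopens X)
      (b : Unit → B) (S : Set X), (j (b ()) : Set X) = S →
      ((Term.equal (Term.var ()) (Term.func BoolFunc.top ![]) : boolLang.Formula Unit).Realize b ↔
        ∀ x, x ∈ S) := by
    rintro B _ j b S rfl
    rw [Formula.realize_equal, ← j.injective.eq_iff, mem_realize_embedding,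
      mem_realize_embedding]
    exact eq_top_iff.trans ⟨fun h x => h trivial, fun h x _ => h x⟩
  induction φ with
  | falsum => exact ⟨Empty, inferInstance, Empty.elim, ⊥, fun _ _ _ _ _ _ _ => Iff.rfl⟩
  | equal t₁ t₂ =>
    refine ⟨Unit, inferInstance, fun _ => .equal t₁ t₂,
      Term.equal (Term.var ()) (Term.func BoolFunc.top ![]), fun e j _ v xs b hb => ?_⟩
    rw [htop j b _ (hb ()), BoundedFormula.Realize, ← e.injective.eq_iff, funext_iff]
    refine forall_congr' fun x => ?_
    rw [apply_realize_term, apply_realize_term, boundedVal, Set.mem_ofPred_eq,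
      BoundedFormula.Realize]
    have h : (fun i => e (Sum.elim v xs i) x) =
        Sum.elim (fun i => e (v i) x) (fun i => e (xs i) x) := by
      ext i; cases i <;> rfl
    rw [h]
  | rel R ts =>
    refine ⟨Unit, inferInstance, fun _ => .rel R ts,
      Term.equal (Term.var ()) (Term.func BoolFunc.top ![]), fun e j _ v xs b hb => ?_⟩
    rw [htop j b _ (hb ()), BoundedFormula.Realize, ← e.map_rel]
    refine forall_congr' fun x => ?_
    rw [boundedVal, Set.mem_ofPred_eq, BoundedFormula.Realize]
    have h : (fun i => e (Sum.elim v xs i) x) =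
        Sum.elim (fun i => e (v i) x) (fun i => e (xs i) x) := by
      ext i; cases i <;> rfl
    simp only [Function.comp_apply, apply_realize_term, h]
  | imp φ₁ φ₂ ih₁ ih₂ =>
    obtain ⟨ι₁, _, ψ₁, Φ₁, h₁⟩ := ih₁
    obtain ⟨ι₂, _, ψ₂, Φ₂, h₂⟩ := ih₂
    refine ⟨ι₁ ⊕ ι₂, inferInstance, Sum.elim ψ₁ ψ₂,
      (Φ₁.relabel Sum.inl).imp (Φ₂.relabel Sum.inr), fun e j hr v xs b hb => ?_⟩
    rw [Formula.realize_imp, Formula.realize_relabel, Formula.realize_relabel,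
      BoundedFormula.realize_imp, h₁ e j hr v xs (b ∘ Sum.inl) fun i => hb (Sum.inl i),
      h₂ e j hr v xs (b ∘ Sum.inr) fun i => hb (Sum.inr i)]
  | all φ ih =>
    -- `allFormula` says that `Φ` holds of every family of sets that could be the family of
    -- truth values at some `y`; the forward direction has to construct such a `y` by gluing.
    obtain ⟨ι, _, ψ, Φ, h⟩ := ih
    refine ⟨Set ι, inferInstance, fun s => (cellFormula ψ s).ex, allFormula Φ,
      fun {E B} _ _ e j hr v xs b hb => ?_⟩
    rw [realize_allFormula Φ j, BoundedFormula.realize_all]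
    have hmem : ∀ s x, x ∈ j (b s) ↔ x ∈ boundedVal e (cellFormula ψ s).ex v xs :=
      fun s x => by rw [← hb s]; rfl
    constructor
    · intro H c hc
      obtain ⟨g, hg⟩ : ∃ g : E, ∀ x, {i | (ψ i).Realize (fun k => e (v k) x)
          (Fin.snoc (fun k => e (xs k) x) (e g x))} = {i | x ∈ j (c i)} := by
        have := hr.nonempty
        refine exists_glue (fun g x => e g x) (Set.range fun b => (j b : Set X)) ?_ ?_ ?_ ?_
          (fun x m => {i | (ψ i).Realize (fun k => e (v k) x)
            (Fin.snoc (fun k => e (xs k) x) m)} = {i | x ∈ j (c i)}) ?_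
        · rintro _ ⟨b, rfl⟩
          exact (j b).isOpen
        · obtain ⟨b₀, h₀⟩ := exists_eq_bot j
          exact ⟨b₀, congrArg SetLike.coe h₀⟩
        · rintro _ ⟨b₁, rfl⟩ _ ⟨b₂, rfl⟩
          obtain ⟨b₀, h₀⟩ := exists_eq_sup j b₁ b₂
          exact ⟨b₀, congrArg SetLike.coe h₀⟩
        · rintro f g _ ⟨b, rfl⟩
          exact hr.patch f g b
        · intro x
          obtain ⟨g, hg⟩ := hr.witness _ v xs x ((hmem _ x).1 (hc x))
          obtain ⟨d, hd⟩ := hr.val (cellFormula ψ {i | x ∈ j (c i)}) v (Fin.snoc xs g)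
          obtain ⟨d', hd'⟩ := exists_eq_inf j d ((cellTerm {i | x ∈ j (c i)}).realize c)
          have hU : ∀ y, y ∈ j d' ↔
              y ∈ boundedVal e (cellFormula ψ {i | x ∈ j (c i)}) v (Fin.snoc xs g) ∧
                {i | y ∈ j (c i)} = {i | x ∈ j (c i)} := fun y => by
            rw [hd', ← hd]
            refine and_congr Iff.rfl ?_
            change y ∈ j ((cellTerm {i | x ∈ j (c i)}).realize c) ↔ _
            rw [mem_realize_embedding, mem_realize_cell]
            rfl
          refine ⟨_, ⟨d', rfl⟩, ?_⟩
          refine ⟨(hU x).2 ⟨hg, rfl⟩, g, fun y hy => ?_⟩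
          obtain ⟨hy₁, hy₂⟩ := (hU y).1 hy
          rw [mem_boundedVal_snoc, realize_cellFormula] at hy₁
          rw [hy₁, hy₂]
      refine (h e j hr v (Fin.snoc xs g) c fun i => ?_).1 (H g)
      ext x
      rw [mem_boundedVal_snoc]
      exact (Set.ext_iff.1 (hg x) i).symm
    · intro H a
      choose c hc using fun i => hr.val (ψ i) v (Fin.snoc xs a)
      refine (h e j hr v (Fin.snoc xs a) c hc).2 (H c fun x => ?_)
      rw [hmem, mem_boundedVal_ex]
      refine ⟨e a x, ?_⟩
      rw [realize_cellFormula]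
      ext i
      rw [Set.mem_ofPred_eq, ← mem_boundedVal_snoc, ← hc i]
      rfl

end FefermanVaught

/-! ### Elementarity of the fibres -/

section Lifting

variable {L : FirstOrder.Language.{u, v}} {X : Type z} [TopologicalSpace X] {M : X → Type w}
  [∀ x, L.Structure (M x)]

theorem IsGammaA.exists_lift
    {T : L.Theory} {A : L.Substructure (∀ x, M x)} (hA : IsGammaA T A) {ι : Type*} (x : X)
    (c : ι → M x) : ∃ f : ι → A, (fun i => (f i).1 x) = c := by
  choose f hf using fun i => hA.subdirect x (c i)
  exact ⟨f, funext hf⟩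

/-- A tuple in one factor that satisfies `φ` lifts to a tuple of `A` that satisfies `φ` everywhere,
provided that `φ` is satisfiable in every factor. -/
theorem IsGammaE.exists_tuple [CompactSpace X] {T : L.Theory} {A : L.Substructure (∀ x, M x)} (hA : IsGammaE T A) {n : ℕ}
    (φ : L.Formula (Fin n)) (hφ : ∀ x, ∃ c : Fin n → M x, φ.Realize c) (x₀ : X)
    (c₀ : Fin n → M x₀) (hc₀ : φ.Realize c₀) :
    ∃ f : Fin n → A, truthVal A φ f = Set.univ ∧ (fun i => (f i).1 x₀) = c₀ := by
  obtain ⟨f₀, rfl⟩ := hA.exists_lift x₀ c₀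
  have : Nonempty (Fin n → A) := ⟨f₀⟩
  -- The predicate also fixes the values on the clopen set `[φ(f₀)]`, which contains `x₀`: the lift
  -- `f₀` is kept there, and is replaced outside.
  obtain ⟨f, hf⟩ := exists_glue (fun (f : Fin n → A) x i => (f i).1 x) {U | IsClopen U}
    (fun U hU => hU.isOpen) isClopen_empty (fun U hU V hV => hU.union hV)
    (fun f g U hU => by
      choose h h₁ h₂ using fun i => hA.patchwork (f i) (g i) U hU
      exact ⟨h, fun x hx => funext fun i => (h₁ i hx).symm,
        fun x hx => funext fun i => (h₂ i hx).symm⟩)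
    (fun x c => φ.Realize c ∧ (x ∈ truthVal A φ f₀ → c = fun i => (f₀ i).1 x))
    (fun x => by
      by_cases hx : x ∈ truthVal A φ f₀
      · exact ⟨_, hA.elementary n φ f₀, hx, f₀, fun y hy => ⟨hy, fun _ => rfl⟩⟩
      · obtain ⟨c, hc⟩ := hφ x
        obtain ⟨g, rfl⟩ := hA.exists_lift x c
        exact ⟨_, (hA.elementary n φ g).inter (hA.elementary n φ f₀).compl, ⟨hc, hx⟩, g,
          fun y hy => ⟨hy.1, fun h => (hy.2 h).elim⟩⟩)
  exact ⟨f, Set.eq_univ_of_forall fun x => (hf x).1, (hf x₀).2 hc₀⟩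

end Lifting

section OpenTheories

variable {L' : FirstOrder.Language.{u, v}}

theorem eq_univ_of_isZariskiClosed_of_infinite {K : Type*} [Field K] {Z : Set (Fin 1 → K)}
    (hZ : IsZariskiClosed Z) (hinf : Z.Infinite) : Z = Set.univ := by
  obtain ⟨I, rfl⟩ := hZ
  refine Set.eq_univ_of_forall fun y p hp => ?_
  let q : Polynomial K := MvPolynomial.aeval (fun _ => Polynomial.X) p
  have hq : ∀ v : Fin 1 → K, MvPolynomial.eval v p = q.eval (v 0) := fun v => by
    change _ = Polynomial.evalRingHom (v 0) (MvPolynomial.aeval (fun _ => Polynomial.X) p)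
    rw [MvPolynomial.map_aeval]
    have h₁ : (Polynomial.evalRingHom (v 0)).comp (algebraMap K (Polynomial K)) =
        RingHom.id K := by ext; simp
    have h₂ : (fun _ : Fin 1 => Polynomial.evalRingHom (v 0) Polynomial.X) = v := by
      ext i; rw [Subsingleton.elim i 0]; simp
    rw [h₁, h₂]
    rfl
  have hq0 : q = 0 := by
    refine Polynomial.eq_zero_of_infinite_isRoot q ?_
    have h := hinf.image (f := fun v : Fin 1 → K => v 0)
      (fun v _ w _ (hvw : v 0 = w 0) => funext fun i => by rwa [Subsingleton.elim i 0])
    refine h.mono ?_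
    rintro _ ⟨v, hv, rfl⟩
    exact (hq v).symm.trans (hv p hp)
  rw [hq, hq0, Polynomial.eval_zero]

/-- An infinite definable subset of an open topological field contains a basic open set: one of
its finitely many pieces `Z ∩ U` is infinite, and a Zariski closed set `Z` in dimension one is
finite or everything. -/
theorem IsOpenTopField.exists_chiSet_subset {k : ℕ}
    {χ : (expLang L').Formula (Fin (k + 1))} {K : Type*} [(expLang L').Structure K] [Field K]
    [TopologicalSpace K] (hK : IsOpenTopField χ K) {C S : Set K}
    (hS : C.Definable₁ (expLang L') S) (hinf : S.Infinite) :
    ∃ (a : K) (b : Fin k → K), 0 ∈ chiSet χ b ∧ ∀ y ∈ chiSet χ b, a + y ∈ S := by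
  have := hK.topField
  obtain ⟨m, Z, U, hZ, hU, hSU⟩ := hK.definable 1 _ (Set.Definable.mono hS (Set.subset_univ C))
  have hinf' : {v : Fin 1 → K | v 0 ∈ S}.Infinite :=
    (hinf.image (f := fun (t : K) (_ : Fin 1) => t) fun s _ t _ h => congrFun h 0).mono <| by
      rintro _ ⟨t, ht, rfl⟩
      exact ht
  obtain ⟨i, hi⟩ : ∃ i, (Z i ∩ U i).Infinite := by
    by_contra! h
    exact hinf' (hSU ▸ Set.finite_iUnion h)
  have hZi := eq_univ_of_isZariskiClosed_of_infinite (hZ i) (hi.mono Set.inter_subset_left)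
  obtain ⟨c, -, hc⟩ := hi.nonempty
  have hcont : Continuous fun (y : K) (_ : Fin 1) => c 0 + y := by fun_prop
  have hmem : (fun (y : K) (_ : Fin 1) => c 0 + y) ⁻¹' U i ∈ nhds (0 : K) := by
    refine ((hU i).preimage hcont).mem_nhds ?_
    have : (fun _ : Fin 1 => c 0 + 0) = c := funext fun j => by
      rw [Subsingleton.elim j 0, add_zero]
    rwa [Set.mem_preimage, this]
  obtain ⟨b, hb, hbU⟩ := hK.basis.mem_iff.1 hmem
  refine ⟨c 0, b, hb, fun y hy => ?_⟩
  have : (fun _ : Fin 1 => c 0 + y) ∈ {v : Fin 1 → K | v 0 ∈ S} := by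
    rw [hSU]
    exact Set.mem_iUnion.2 ⟨i, hZi ▸ trivial, hbU hy⟩
  exact this

variable {X : Type z} {M : X → Type w}
  [∀ x, (expLang L').Structure (M x)]

theorem coe_fieldOp {A : (expLang L').Substructure (∀ x, M x)} {n : ℕ} (o : FieldFunc n)
    (a : Fin n → A) (x : X) :
    (fieldOp (L' := L') o a).1 x = fieldOp (L' := L') o fun i => (a i).1 x :=
  rfl

theorem mem_truthVal_cons {A : (expLang L').Substructure (∀ x, M x)} {k : ℕ}
    (χ : (expLang L').Formula (Fin (k + 1))) (a : A) (f : Fin k → A) (x : X) :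
    x ∈ truthVal A χ (Fin.cons a f : Fin (k + 1) → A) ↔
      a.1 x ∈ chiSet χ fun i => (f i).1 x := by
  have h : (fun i => ((Fin.cons a f : Fin (k + 1) → A) i).1 x) =
      (Fin.cons (a.1 x) fun i => (f i).1 x : Fin (k + 1) → M x) := by
    ext i
    refine Fin.cases ?_ (fun i => ?_) i <;> simp
  rw [truthVal, Set.mem_ofPred_eq, h]
  rfl

/-- The formula `χ(0, z)` in the variables `z`. -/
def chiZero {k : ℕ} (χ : (expLang L').Formula (Fin (k + 1))) : (expLang L').Formula (Fin k) :=
  BoundedFormula.subst χ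
    (Fin.cons (Term.func (L := expLang L') (l := 0) (Sum.inl FieldFunc.zero) ![]) Term.var)

theorem realize_chiZero {k : ℕ} (χ : (expLang L').Formula (Fin (k + 1))) {K : Type*}
    [(expLang L').Structure K] (c : Fin k → K) :
    (chiZero χ).Realize c ↔ fieldOp (L' := L') FieldFunc.zero ![] ∈ chiSet χ c := by
  rw [chiZero, Formula.Realize, BoundedFormula.realize_subst, chiSet, Set.mem_ofPred_eq,
    Formula.Realize]
  refine iff_of_eq (congrArg (fun t => BoundedFormula.Realize χ t _) ?_)
  ext i
  refine Fin.cases ?_ (fun i => ?_) i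
  · rw [Fin.cons_zero, Fin.cons_zero]
    exact congrArg (funMap _) (Subsingleton.elim _ _)
  · simp

/-- Each `D_x` is an elementary substructure of the factor at `x`, because it meets every nonempty
definable set: finite ones are contained in it by algebraic closedness, and infinite ones contain
an open set, which it meets by density. -/
theorem fiber_isElementary [TopologicalSpace X] [CompactSpace X] {T : (expLang L').Theory} {k : ℕ}
    {χ : (expLang L').Formula (Fin (k + 1))} (hχ : IsOpenTheory.{u, v, w} T χ)
    {A : (expLang L').Substructure (∀ x, M x)} (hA : IsGammaE T A)
    {D : (expLang L').Substructure A} (hAD : IsWeakDensePair χ D) (x : X) :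
    (fiber D x).IsElementary := by
  have hmeets : (expLang L').MeetsDefinable (fiber D x : Set (M x)) := by
    intro S hne hS
    by_cases hfin : S.Finite
    · rwa [Set.inter_eq_left.2 (hAD.aclClosed x S hfin hS)]
    obtain ⟨_, _, hK⟩ := hχ (M x) (hA.model x)
    obtain ⟨a, b, hb, hab⟩ := hK.exists_chiSet_subset hS hfin
    -- lift `a` and `b` to `A`, in such a way that `χ(0, b)` holds at every point
    obtain ⟨a', rfl⟩ := hA.subdirect x a
    obtain ⟨f, hf, rfl⟩ := hA.exists_tuple (chiZero χ)
      (fun y => by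
        obtain ⟨_, _, hy⟩ := hχ (M y) (hA.model y)
        obtain ⟨c, hc, -⟩ := hy.basis.mem_iff.1 Filter.univ_mem
        exact ⟨c, (realize_chiZero χ c).2 (hy.interpretation.zero ▸ hc)⟩) x b
      ((realize_chiZero χ b).2 (hK.interpretation.zero ▸ hb))
    -- `a'` is moved into `D` by an element of the basic neighbourhood `χ(A, f)` of zero
    obtain ⟨d, hd, hdD⟩ := hAD.dense a' f <| by
      refine Set.eq_univ_of_forall fun y => ?_
      have h : y ∈ truthVal A (chiZero χ) f := hf ▸ Set.mem_univ y
      rw [mem_truthVal_cons, coe_fieldOp, Subsingleton.elim (fun i => _) (![])]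
      exact (realize_chiZero χ _).1 h
    have hdx : x ∈ truthVal A χ (Fin.cons d f) := by
      exact (Set.eq_univ_iff_forall.1 hd) x
    refine ⟨a'.1 x + d.1 x, hab _ ((mem_truthVal_cons χ d f x).1 hdx), _, hdD, ?_⟩
    refine (coe_fieldOp FieldFunc.plus ![a', d] x).trans ?_
    rw [← hK.interpretation.plus]
    congr 1
    ext i
    fin_cases i <;> rfl
  have := hmeets.isElementary_closure
  rwa [Substructure.closure_eq] at this

end OpenTheories

/-! ### The two representations -/

section Representations

variable {L : FirstOrder.Language.{u, v}} {X : Type z} [TopologicalSpace X] {M : X → Type w}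
  [∀ x, L.Structure (M x)] {T : L.Theory} {A : L.Substructure (∀ x, M x)}

theorem IsGammaE.isBooleanRep (hA : IsGammaE T A) [Nonempty A] :
    IsBooleanRep A.subtype (Embedding.refl boolLang (Clopens X)) where
  nonempty := inferInstance
  val φ v xs := by
    obtain ⟨ψ, f, h⟩ := exists_formula_eq_boundedVal A.subtype φ v xs
    exact ⟨⟨_, hA.elementary _ ψ f⟩, h.symm⟩
  witness φ v xs x hx := by
    obtain ⟨m, hm⟩ := (mem_boundedVal_ex _ _ _ _ _).1 hx
    obtain ⟨g, rfl⟩ := hA.subdirect x m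
    exact ⟨g, (mem_boundedVal_snoc _ _ _ _ _ _).2 hm⟩
  patch f g b := by
    obtain ⟨h, hf, hg⟩ := hA.patchwork f g b b.isClopen
    exact ⟨h, fun x hx => (hf hx).symm, fun x hx => (hg hx).symm⟩

/-- If the fibres of `D` are elementary, truth in them agrees with truth in the factors, so that
`D` is represented over the same factors as `A`, with respect to the smaller algebra. -/
theorem IsSubGammaE.isBooleanRep {D : L.Substructure A} (hD : IsSubGammaE D) [Nonempty D]
    (hfib : ∀ x, (fiber D x).IsElementary) :
    IsBooleanRep (A.subtype.comp D.subtype) (clopenAlg D).subtype where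
  nonempty := inferInstance
  val φ v xs := by
    obtain ⟨ψ, f, h⟩ := exists_formula_eq_boundedVal (A.subtype.comp D.subtype) φ v xs
    have hψ : boundedVal (A.subtype.comp D.subtype) φ v xs = subTruthVal D ψ f :=
      h.trans (Set.ext fun x => hfib x ψ fun i => fiberVal D x (f i))
    exact ⟨⟨⟨_, hD.elementary _ ψ f⟩, _, ψ, f, rfl⟩, hψ.symm⟩
  witness φ v xs x hx := by
    let S : L.ElementarySubstructure (M x) := ⟨fiber D x, hfib x⟩
    have hS := S.subtype.map_boundedFormula φ.ex (fun i => fiberVal D x (v i))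
      (fun i => fiberVal D x (xs i))
    obtain ⟨⟨_, d, hd, rfl⟩, hm⟩ := BoundedFormula.realize_ex.1 (hS.1 hx)
    refine ⟨⟨d, hd⟩, (mem_boundedVal_snoc _ _ _ _ _ _).2 ?_⟩
    have := (S.subtype.map_boundedFormula φ _ _).2 hm
    rw [Fin.comp_snoc] at this
    exact this
  patch f g b := by
    obtain ⟨h, hf, hg⟩ := hD.patchwork f g b b.2
    exact ⟨h, fun x hx => (hf hx).symm, fun x hx => (hg hx).symm⟩

/-- A substructure of a Boolean product with patchwork over its own truth values is elementary as
soon as its fibres and its Boolean algebra are. -/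
theorem IsSubGammaE.isElementary [CompactSpace X] {D : L.Substructure A} [Nonempty D]
    (hD : IsSubGammaE D) (hA : IsGammaE T A) (hfib : ∀ x, (fiber D x).IsElementary)
    (hB : (clopenAlg D).IsElementary) : D.IsElementary := by
  intro n φ f
  have : Nonempty A := Nonempty.map Subtype.val ‹Nonempty D›
  obtain ⟨ι, _, ψ, Φ, h⟩ := exists_boolFormula (M := M) φ
  have hrep := hD.isBooleanRep hfib
  choose b hb using fun i => hrep.val (ψ i) f default
  have hAΦ := h A.subtype _ hA.isBooleanRep (Subtype.val ∘ f) default (Subtype.val ∘ b)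
    fun i => (hb i).trans <| congrArg (boundedVal A.subtype (ψ i) (Subtype.val ∘ f)) <|
      Subsingleton.elim (Subtype.val ∘ default) default
  have hDΦ := h _ _ hrep f default b hb
  let S : boolLang.ElementarySubstructure (Clopens X) := ⟨clopenAlg D, hB⟩
  exact hAΦ.trans ((S.subtype.map_formula Φ b).trans hDΦ.symm)

end Representations

end BoolProd

theorem lemma5p3 {L' : FirstOrder.Language.{u, v}}
    (hL' : ∀ n, IsEmpty (L'.Functions (n + 1)))
    (T : (BoolProd.expLang L').Theory) (hT : T.IsComplete)
    {k : ℕ} (χ : (BoolProd.expLang L').Formula (Fin (k + 1)))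
    (hχ : BoolProd.IsOpenTheory.{u, v, w} T χ)
    {X : Type z} [TopologicalSpace X] [CompactSpace X] [T2Space X] [TotallyDisconnectedSpace X]
    {M : X → Type w} [∀ x, (BoolProd.expLang L').Structure (M x)]
    (A : (BoolProd.expLang L').Substructure (∀ x, M x)) (hA : BoolProd.IsGammaE T A)
    (D : (BoolProd.expLang L').Substructure A) (hD : BoolProd.IsSubGammaE D)
    (hAD : BoolProd.IsWeakDensePair χ D) :
    D.IsElementary := by
  have : Nonempty D := ⟨BoolProd.fieldOp (L' := L') BoolProd.FieldFunc.zero ![]⟩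
  exact hD.isElementary hA (BoolProd.fiber_isElementary hχ hA hAD) hAD.clopenAlg_elementary
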